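/- Let $R$ be a reduced irreducible (crystallographic) root system spanning a real Euclidean space $E$, with Weyl group $W$, positive roots $R^+$, weight lattice $\mathcal P$, dominant weights $\mathcal P^+=\{\lambda\in E\mid\langle\lambda,\alpha^\vee\rangle\in\mathbb N\ \forall\alpha\in R^+\}$ (here $0\in\mathbb N$), and $\mathcal Q^+=\mathrm{Span}_{\mathbb N}(R^+)$. For weights write $\mu\prec\lambda$ if $\mu\neq\lambda$ and $\lambda-\mu\in\mathcal Q^+$. Let $\rho=\frac12\sum_{\alpha\in R^+}\alpha$ and $\delta=\prod_{\alpha\in R^+}(e^{\alpha/2}-e^{-\alpha/2})$. For $\lambda\in\mathcal P$ let $W(\lambda)$ be its Weyl orbit, let $m_\lambda=\sum_{\nu\in W(\lambda)}e^\nu$ be the monomial symmetric function, let $$\chi_\lambda=\delta^{-1}\sum_{w\in W}\det(w)\,e^{w(\lambda+\rho)}$$ be the Weyl character, and let $w_\lambda\in W$ be the unique shortest element such that $w_\lambda(\lambda)\in\mathcal P^+$. Then for every $\lambda\in\mathcal P^+$ there are only finitely many $\mu\in\mathcal P^+$ with $\mu\prec\lambda$, and $$m_\lambda=\chi_\lambda+\sum_{\mu\in\mathcal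 P^+,\ \mu\prec\lambda}a_{\lambda\mu}\,\chi_\mu,\qquad a_{\lambda\mu}=\sum_{\nu\in W(\lambda)\cap(W(\mu+\rho)-\rho)}\det(w_{\rho+\nu}).$$ -/

import Mathlib

noncomputable section

/-- The group algebra `ℝ[E]` of formal exponentials of a real vector space is a domain, so that
its field of fractions, where one can divide by the Weyl denominator, makes sense. -/
instance isDomain_formalExponentials (E : Type*) [AddCommGroup E] [Module ℝ E] :
    IsDomain (AddMonoidAlgebra ℝ E) := by
  let _ : Module ℚ E := Module.compHom E (algebraMap ℚ ℝ)
  have : NoZeroDivisors (AddMonoidAlgebra ℝ E) := inferInstance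
  exact NoZeroDivisors.to_isDomain _

namespace WeylCharacter

variable {ι E F : Type*} [Finite ι] [AddCommGroup E] [Module ℝ E] [AddCommGroup F] [Module ℝ F]

/-- The formal exponential `e^v`, `v ∈ E`. (The exponents range over all of `E`, which contains
the weight lattice as well as the half roots and the half sum of the positive roots.) -/
def fexp (v : E) : AddMonoidAlgebra ℝ E := AddMonoidAlgebra.single v 1

variable {P : RootPairing ι ℝ E F}

/-- The determinant of a Weyl group element, as a linear map of `E`. -/
def wdet (w : P.weylGroup) : ℝ := LinearMap.det (P.weylGroupRootRep w)

variable (P) in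
/-- The weight lattice: `⟨v, α^∨⟩ ∈ ℤ` for all roots `α`. -/
def weightLattice : Set E := {v | ∀ i, ∃ n : ℤ, P.coroot' i v = n}

/-- The symmetric monomial `m_v`, the sum of the exponentials over the Weyl group orbit of `v`. -/
def monomial (P : RootPairing ι ℝ E F) (v : E) : AddMonoidAlgebra ℝ E :=
  ∑ᶠ u ∈ MulAction.orbit P.weylGroup v, fexp u

section Base

variable [P.IsRootSystem] [P.IsCrystallographic] [P.IsReduced] (b : P.Base)

/-- The dominant weights: `⟨v, α^∨⟩ ∈ ℕ` for all positive roots `α`. -/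
def dominantWeights : Set E := {v | ∀ i, b.IsPos i → ∃ n : ℕ, P.coroot' i v = n}

/-- The semigroup generated by the positive roots (including `0`). -/
def positiveRootCone : AddSubmonoid E := AddSubmonoid.closure (P.root '' {i | b.IsPos i})

/-- The strict partial order `u ≺ v` on weights: `v - u` is a nonzero element of the semigroup
generated by the positive roots. -/
def StrictlyBelow (u v : E) : Prop := v - u ∈ positiveRootCone b ∧ u ≠ v

/-- The half sum of the positive roots. -/
def rho : E := (1 / 2 : ℝ) • ∑ᶠ (i) (_ : b.IsPos i), P.root i

/-- The Weyl denominator `δ = ∏ (e^{α/2} - e^{-α/2})`, over the positive roots `α`. -/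
def denominator : AddMonoidAlgebra ℝ E :=
  ∏ᶠ (i) (_ : b.IsPos i),
    (fexp ((1 / 2 : ℝ) • P.root i) - fexp (-((1 / 2 : ℝ) • P.root i)))

/-- The alternating sum `∑ det(w) e^{w(v)}` over the Weyl group. -/
def alternant (P : RootPairing ι ℝ E F) (v : E) : AddMonoidAlgebra ℝ E :=
  ∑ᶠ w : P.weylGroup, wdet w • fexp (w • v)

/-- The Weyl character `χ_v = δ⁻¹ ∑ det(w) e^{w(v + ρ)}`, in the field of fractions of the
algebra of formal exponentials. -/
def weylCharacter (v : E) : FractionRing (AddMonoidAlgebra ℝ E) :=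
  (algebraMap (AddMonoidAlgebra ℝ E) (FractionRing (AddMonoidAlgebra ℝ E)) (denominator b))⁻¹ *
    algebraMap (AddMonoidAlgebra ℝ E) (FractionRing (AddMonoidAlgebra ℝ E))
      (alternant P (v + rho b))

/-- The length of a Weyl group element: the least number of factors in an expression as a product
of simple reflections (the simple reflections generate the Weyl group, so the set is nonempty). -/
def length (w : P.weylGroup) : ℕ :=
  sInf {n | ∃ l : List b.support, l.length = n ∧
    (l.map fun i => RootPairing.weylGroup.ofIdx P (i : ι)).prod = w}

/-- `w` is an element of least length among those mapping `v` to a dominant weight. -/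
def IsShortestDominating (v : E) (w : P.weylGroup) : Prop :=
  w • v ∈ dominantWeights b ∧
    ∀ w' : P.weylGroup, w' • v ∈ dominantWeights b → length b w ≤ length b w'

/-- The shortest Weyl group element `w_v` that maps the weight `v` to a dominant weight. (It is
unique; that one exists is `exists_isShortestDominating` below.) -/
def shortestDominating (v : E) : P.weylGroup := Classical.epsilon (IsShortestDominating b v)

/-- The coefficient `a_{λμ}` for `λ = v` and `μ = u`: the sum of `det(w_{ρ+ν})` over `ν ∈ W(λ) ∩ (W(μ + ρ) - ρ)`. -/
def inverseKostka (v u : E) : ℝ :=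
  ∑ᶠ x ∈ MulAction.orbit P.weylGroup v ∩
      (fun y => y - rho b) '' MulAction.orbit P.weylGroup (u + rho b),
    wdet (shortestDominating b (rho b + x))

/-! The sums and products above are finite, the denominator is nonzero, and the shortest element
mapping a weight to a dominant one exists. -/

instance finite_weylGroup (P : RootPairing ι ℝ E F) [P.IsRootSystem] : Finite P.weylGroup := by
  refine Finite.of_injective (fun w : P.weylGroup => (P.weylGroupToPerm w : Equiv.Perm ι)) ?_
  intro w w' h
  have hr : ∀ i, w • P.root i = w' • P.root i := fun i => by
    rw [P.weylGroup_apply_root, P.weylGroup_apply_root]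
    exact congrArg (fun σ : Equiv.Perm ι => P.root (σ i)) h
  apply Subtype.ext
  apply RootPairing.Equiv.weightHom_injective P
  apply LinearEquiv.toLinearMap_injective
  refine LinearMap.ext_on_range (v := P.root) ?_ hr
  exact RootPairing.IsRootSystem.span_root_eq_top

theorem denominator_ne_zero : denominator b ≠ 0 := by
  refine finprod_induction (p := fun z : AddMonoidAlgebra ℝ E => z ≠ 0) one_ne_zero
    (fun _ _ => mul_ne_zero) fun i => ?_
  refine finprod_induction (p := fun z : AddMonoidAlgebra ℝ E => z ≠ 0) one_ne_zero
    (fun _ _ => mul_ne_zero) fun _ h => ?_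
  have h1 : (1 / 2 : ℝ) • P.root i = -((1 / 2 : ℝ) • P.root i) :=
    AddMonoidAlgebra.single_left_injective (one_ne_zero (α := ℝ)) (sub_eq_zero.mp h)
  have h2 : P.root i = 0 := by
    rw [eq_neg_iff_add_eq_zero, ← add_smul] at h1
    norm_num at h1
    exact h1
  exact P.ne_zero i h2

theorem smul_mem_weightLattice {v : E} (hv : v ∈ weightLattice P) (w : P.weylGroup) :
    w • v ∈ weightLattice P := by
  obtain ⟨w, hw⟩ := w
  induction hw using RootPairing.weylGroup.induction generalizing v with
  | mem j =>
    intro i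
    obtain ⟨n, hn⟩ := hv i
    obtain ⟨m, hm⟩ := hv j
    obtain ⟨k, hk⟩ := RootPairing.IsValuedIn.exists_value (P := P) (S := ℤ) j i
    refine ⟨n - m * k, ?_⟩
    change P.coroot' i (P.reflection j v) = _
    rw [P.reflection_apply, map_sub, LinearMap.map_smul, hn, hm, P.root_coroot'_eq_pairing, ← hk]
    push_cast
    simp
  | one => exact hv
  | mul w₁ w₂ h₁ h₂ ih₁ ih₂ => exact ih₁ (ih₂ hv)

theorem exists_isShortestDominating {v : E} (hv : v ∈ weightLattice P) :
    ∃ w, IsShortestDominating b v w := by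
  classical
  let f : E →ₗ[ℝ] ℝ := b.toWeightBasis.constr ℝ fun _ => (1 : ℝ)
  have hf : ∀ i, b.IsPos i → 0 < f (P.root i) := by
    intro i hi
    obtain ⟨g, -, -, hg⟩ := b.exists_root_eq_sum_int i
    have h1 : ∀ j ∈ b.support, f (P.root j) = 1 := fun j hj => by
      have := b.toWeightBasis.constr_basis ℝ (fun _ => (1 : ℝ)) ⟨j, hj⟩
      rwa [RootPairing.Base.toWeightBasis_apply] at this
    rw [RootPairing.Base.isPos_iff, RootPairing.Base.height_eq_sum hg] at hi
    rw [hg, map_sum, Finset.sum_congr rfl fun j hj => by rw [map_zsmul, h1 j hj]]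
    simpa using (by exact_mod_cast hi : (0 : ℝ) < ((∑ j ∈ b.support, g j : ℤ) : ℝ))
  obtain ⟨w, hw⟩ := Finite.exists_max fun w : P.weylGroup => f (w • v)
  have hd : ∃ n, ∃ w : P.weylGroup, w • v ∈ dominantWeights b ∧ length b w = n := by
    refine ⟨_, w, fun i hi => ?_, rfl⟩
    obtain ⟨n, hn⟩ := smul_mem_weightLattice hv w i
    have h2 := hw (RootPairing.weylGroup.ofIdx P i * w)
    rw [mul_smul, RootPairing.weylGroup.ofIdx_smul, RootPairing.Equiv.reflection_smul,
      P.reflection_apply, hn, map_sub, LinearMap.map_smul, smul_eq_mul] at h2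
    have h3 : 0 ≤ n := by
      by_contra! h
      have : (n : ℝ) < 0 := by exact_mod_cast h
      nlinarith [hf i hi]
    exact ⟨n.toNat, by rw [hn]; exact_mod_cast (Int.toNat_of_nonneg h3).symm⟩
  obtain ⟨w, hw, hn⟩ := Nat.find_spec hd
  exact ⟨w, hw, fun w' hw' => hn.le.trans (Nat.find_min' hd ⟨w', hw', rfl⟩)⟩

theorem shortestDominating_spec {v : E} (hv : v ∈ weightLattice P) :
    IsShortestDominating b v (shortestDominating b v) :=
  Classical.epsilon_spec (exists_isShortestDominating b hv)

end Base

end WeylCharacter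

end

noncomputable section
set_option linter.unusedSectionVars false
namespace WeylCharacter

open RootPairing

variable {ι E F : Type*} [Finite ι] [AddCommGroup E] [Module ℝ E] [AddCommGroup F] [Module ℝ F]
variable {P : RootPairing ι ℝ E F}

/-! Write J_x for `alternant P x`. Multiplying by the nonzero δ turns χ_μ into J_{μ+ρ}, and the Weyl
denominator formula δ = J_ρ (`denominator_eq_alternant`) turns δ m_λ into the sum of J_{ν+ρ} over ν
∈ W(λ) (`monomial_mul_alternant`). Move each ν+ρ into the dominant chamber: if it lands on a wall, J
vanishes; otherwise J_{ν+ρ} = det(w_{ρ+ν}) J_{μ+ρ} for one dominant μ, and λ - μ lies in the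
positive cone (`alternant_add_rho_eq_sum`). Collecting terms by μ gives a_{λμ}, with a_{λλ} = 1
(`inverseKostka_self`). A contributing ν has ρ+ν regular, so only one element makes it dominant and
minimality of length plays no role.

The combinatorics rest on descent in the Weyl group (`descent_induction`), which puts x - wx in the
positive cone for dominant x, and on that cone being pointed (`eq_zero_of_mem_of_neg_mem`). The
denominator formula holds because δ is antisymmetric with highest exponent ρ. -/

/-! ### Weyl group action on weights and exponentials; determinants. -/

theorem ofIdx_smul_eq (i : ι) (x : E) :
    weylGroup.ofIdx P i • x = x - P.coroot' i x • P.root i := by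
  rw [weylGroup.ofIdx_smul, Equiv.reflection_smul, P.reflection_apply]

theorem ofIdx_mul_self (i : ι) : weylGroup.ofIdx P i * weylGroup.ofIdx P i = 1 := by
  apply Subtype.ext
  change Equiv.reflection P i * Equiv.reflection P i = 1
  rw [mul_eq_one_iff_inv_eq, Equiv.reflection_inv P i]

theorem smul_real_smul (w : P.weylGroup) (c : ℝ) (x : E) : w • c • x = c • w • x :=
  (P.weylGroupRootRep w).map_smul c x

theorem weylGroupToPerm_ofIdx (i j : ι) :
    P.weylGroupToPerm (weylGroup.ofIdx P i) j = P.reflectionPerm i j := rfl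

theorem coroot'_weylGroupToPerm_smul (w : P.weylGroup) (i : ι) (x : E) :
    P.coroot' (P.weylGroupToPerm w i) (w • x) = P.coroot' i x := by
  obtain ⟨w, hw⟩ := w
  induction hw using RootPairing.weylGroup.induction generalizing i x with
  | mem j =>
    change P.coroot' (P.reflectionPerm j i) (P.reflection j x) = _
    rw [P.coroot'_reflectionPerm]
    simp
  | one => rfl
  | mul w₁ w₂ h₁ h₂ ih₁ ih₂ => exact (ih₁ _ _).trans (ih₂ _ _)

theorem wdet_one : wdet (1 : P.weylGroup) = 1 := by simp [wdet]

theorem wdet_mul (w w' : P.weylGroup) : wdet (w * w') = wdet w * wdet w' := by simp [wdet]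

theorem fexp_mul_fexp (x y : E) : fexp x * fexp y = fexp (x + y) := by
  simp [fexp]

theorem coeff_fexp [DecidableEq E] (x y : E) : (fexp x).coeff y = if x = y then 1 else 0 := by
  rw [fexp, AddMonoidAlgebra.coeff_single, Finsupp.single_apply]

theorem coeff_fexp_mul (x y : E) (z : AddMonoidAlgebra ℝ E) :
    (fexp x * z).coeff y = z.coeff (y - x) := by
  rw [fexp, AddMonoidAlgebra.coeff_single_mul_eq_mul_coeff (m₂ := y - x), one_mul]
  intro m _
  rw [eq_sub_iff_add_eq, add_comm]

/-- The action of the Weyl group on the algebra of formal exponentials. -/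
def actHom (w : P.weylGroup) : AddMonoidAlgebra ℝ E →+* AddMonoidAlgebra ℝ E :=
  AddMonoidAlgebra.mapDomainRingHom ℝ (DistribSMul.toAddMonoidHom E w)

theorem actHom_fexp (w : P.weylGroup) (x : E) : actHom w (fexp x) = fexp (w • x) := by
  simp [actHom, fexp]

theorem coeff_actHom (w : P.weylGroup) (z : AddMonoidAlgebra ℝ E) (x : E) :
    (actHom w z).coeff (w • x) = z.coeff x :=
  Finsupp.mapDomain_apply (MulAction.injective w) z.coeff x

section RootSystem

variable [P.IsRootSystem]

theorem wdet_ofIdx (b : P.Base) (i : ι) : wdet (weylGroup.ofIdx P i) = -1 := by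
  have : Module.Free ℝ E := Module.Free.of_basis b.toWeightBasis
  have : Module.Finite ℝ E := Module.Finite.of_basis b.toWeightBasis
  -- As a transvection, the reflection has determinant 1 - ⟨α, α^∨⟩ = 1 - 2.
  have h : P.weylGroupRootRep (weylGroup.ofIdx P i) =
      LinearMap.transvection (-P.coroot' i) (P.root i) := by
    ext x
    rw [LinearMap.transvection.apply, LinearMap.neg_apply, neg_smul, ← sub_eq_add_neg]
    exact ofIdx_smul_eq i x
  rw [wdet, h, LinearMap.transvection.det]
  simp
  norm_num

theorem wdet_mul_self (b : P.Base) (w : P.weylGroup) : wdet w * wdet w = 1 := by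
  obtain ⟨w, hw⟩ := w
  induction hw using RootPairing.weylGroup.induction with
  | mem j =>
    have := wdet_ofIdx b j
    unfold weylGroup.ofIdx at this
    rw [this]; norm_num
  | one => exact (by rw [wdet_one, one_mul] : wdet (1 : P.weylGroup) * wdet (1 : P.weylGroup) = 1)
  | mul w₁ w₂ h₁ h₂ ih₁ ih₂ =>
    have := wdet_mul (⟨w₁, h₁⟩ : P.weylGroup) ⟨w₂, h₂⟩
    change wdet (⟨w₁, h₁⟩ * ⟨w₂, h₂⟩ : P.weylGroup) * wdet (⟨w₁, h₁⟩ * ⟨w₂, h₂⟩ : P.weylGroup) = 1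
    rw [this]
    linear_combination ih₁ * wdet (⟨w₂, h₂⟩ : P.weylGroup) * wdet (⟨w₂, h₂⟩ : P.weylGroup) + ih₂

end RootSystem

section Base

variable [P.IsRootSystem] [P.IsCrystallographic] [P.IsReduced] (b : P.Base)

/-! ### Words in simple reflections, exchange and descent. -/

theorem isPos_reflectionPerm_self_iff (i : ι) :
    b.IsPos (P.reflectionPerm i i) ↔ ¬ b.IsPos i := Base.IsPos.neg_iff_not b i

theorem ofIdx_reflectionPerm (i j : ι) :
    weylGroup.ofIdx P (P.reflectionPerm j i) =
      weylGroup.ofIdx P j * weylGroup.ofIdx P i * weylGroup.ofIdx P j := by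
  apply Subtype.ext
  apply RootPairing.Equiv.weightHom_injective P
  apply LinearEquiv.toLinearMap_injective
  ext x
  change P.reflection (P.reflectionPerm j i) x = _
  rw [P.reflection_reflectionPerm]
  rfl

/-- The product of the simple reflections in a word. -/
def wordProd (l : List b.support) : P.weylGroup :=
  (l.map fun i => weylGroup.ofIdx P (i : ι)).prod

theorem wordProd_nil : wordProd b [] = 1 := rfl

theorem wordProd_cons (i : b.support) (l : List b.support) :
    wordProd b (i :: l) = weylGroup.ofIdx P (i : ι) * wordProd b l := by
  simp [wordProd]

theorem wordProd_append (l l' : List b.support) :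
    wordProd b (l ++ l') = wordProd b l * wordProd b l' := by
  simp [wordProd]

/-- The simple reflections generate the Weyl group. -/
theorem exists_wordProd_eq (w : P.weylGroup) : ∃ l, wordProd b l = w := by
  have hm : ∀ w w' : P.weylGroup, (∃ l, wordProd b l = w) → (∃ l, wordProd b l = w') →
      ∃ l, wordProd b l = w * w' := by
    rintro _ _ ⟨l, rfl⟩ ⟨l', rfl⟩
    exact ⟨l ++ l', wordProd_append b l l'⟩
  have hr : ∀ i, ∃ l, wordProd b l = weylGroup.ofIdx P i := by
    intro i
    refine b.induction_reflect i (p := fun i => ∃ l, wordProd b l = weylGroup.ofIdx P i)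
      (fun i hi => ?_) (fun i hi => ⟨[⟨i, hi⟩], by simp [wordProd]⟩) (fun i j hi hj => ?_)
    · rw [ofIdx_reflectionPerm]
      exact hm _ _ (hm _ _ hi hi) hi
    · rw [ofIdx_reflectionPerm]
      have : ∃ l, wordProd b l = weylGroup.ofIdx P j := ⟨[⟨j, hj⟩], by simp [wordProd]⟩
      exact hm _ _ (hm _ _ this hi) this
  obtain ⟨w, hw⟩ := w
  induction hw using RootPairing.weylGroup.induction with
  | mem j => exact hr j
  | one => exact ⟨[], rfl⟩
  | mul w₁ w₂ h₁ h₂ ih₁ ih₂ => exact hm _ _ ih₁ ih₂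

theorem weylGroupToPerm_mul_ofIdx_self (w : P.weylGroup) (i : ι) :
    b.IsPos (P.weylGroupToPerm (w * weylGroup.ofIdx P i) i) ↔ ¬ b.IsPos (P.weylGroupToPerm w i) := by
  rw [← isPos_reflectionPerm_self_iff]
  suffices P.weylGroupToPerm (w * weylGroup.ofIdx P i) i =
      P.reflectionPerm (P.weylGroupToPerm w i) (P.weylGroupToPerm w i) by rw [this]
  apply P.root.injective
  rw [← P.weylGroup_apply_root, P.root_reflectionPerm, mul_smul, ofIdx_smul_eq,
    P.reflection_apply_self, ← P.weylGroup_apply_root, P.root_coroot'_eq_pairing, P.pairing_same,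
    two_smul, sub_add_cancel_left, smul_neg]

theorem mul_ofIdx_mul_ofIdx (w : P.weylGroup) (i : ι) :
    w * weylGroup.ofIdx P i * weylGroup.ofIdx P i = w := by
  rw [mul_assoc, ofIdx_mul_self, mul_one]

/-- The exchange condition. -/
theorem exists_wordProd_eq_mul_ofIdx (l : List b.support) {i : ι} (hi : i ∈ b.support)
    (h : ¬ b.IsPos (P.weylGroupToPerm (wordProd b l) i)) :
    ∃ l' : List b.support, l'.length + 1 = l.length ∧
      wordProd b l' = wordProd b l * weylGroup.ofIdx P i := by
  induction l with
  | nil => exact absurd (Base.isPos_of_mem_support hi) h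
  | cons j l ih =>
    -- A simple reflection s_j makes only one positive root negative, α_j itself. So at the letter
    -- where the image of α_i changes sign, that image is α_j; this letter is the one to delete.
    by_cases h' : b.IsPos (P.weylGroupToPerm (wordProd b l) i)
    · refine ⟨l, rfl, ?_⟩
      have hj : P.weylGroupToPerm (wordProd b l) i = j := by
        by_contra hne
        refine h ?_
        rw [wordProd_cons, map_mul]
        exact h'.reflectionPerm j.2 hne
      have hc : weylGroup.ofIdx P (j : ι) * wordProd b l = wordProd b l * weylGroup.ofIdx P i := by
        apply Subtype.ext
        apply RootPairing.Equiv.weightHom_injective P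
        apply LinearEquiv.toLinearMap_injective
        ext x
        change weylGroup.ofIdx P (j : ι) • wordProd b l • x =
          wordProd b l • weylGroup.ofIdx P i • x
        rw [ofIdx_smul_eq, ofIdx_smul_eq, smul_sub, smul_real_smul, P.weylGroup_apply_root,
          ← hj, coroot'_weylGroupToPerm_smul]
      rw [wordProd_cons, hc, mul_ofIdx_mul_ofIdx]
    · obtain ⟨l', h1, h2⟩ := ih h'
      exact ⟨j :: l', by simp [h1], by rw [wordProd_cons, wordProd_cons, h2, mul_assoc]⟩

/-- Descent induction: a nontrivial element of the Weyl group makes some simple root negative. -/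
theorem descent_induction {p : P.weylGroup → Prop} (one : p 1)
    (step : ∀ w : P.weylGroup, ∀ i ∈ b.support, ¬ b.IsPos (P.weylGroupToPerm w i) →
      p (w * weylGroup.ofIdx P i) → p w) (w : P.weylGroup) : p w := by
  suffices ∀ n, ∀ l : List b.support, l.length = n → p (wordProd b l) by
    obtain ⟨l, rfl⟩ := exists_wordProd_eq b w
    exact this _ l rfl
  intro n
  induction n using Nat.strong_induction_on with
  | _ n ih =>
    intro l hl
    rcases List.eq_nil_or_concat' l with rfl | ⟨l, i, rfl⟩
    · exact one
    have hw : wordProd b (l ++ [i]) * weylGroup.ofIdx P (i : ι) = wordProd b l := by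
      rw [wordProd_append, wordProd_cons, wordProd_nil, mul_one, mul_ofIdx_mul_ofIdx]
    rw [List.length_append, List.length_singleton] at hl
    by_cases h : b.IsPos (P.weylGroupToPerm (wordProd b (l ++ [i])) i)
    -- If the last letter is not a descent, exchange applied to the remaining word yields a word for
    -- the same element, two letters shorter.
    · have h' : ¬ b.IsPos (P.weylGroupToPerm (wordProd b l) i) := by
        rw [← hw, weylGroupToPerm_mul_ofIdx_self, not_not]
        exact h
      obtain ⟨l', h1, h2⟩ := exists_wordProd_eq_mul_ofIdx b l i.2 h'
      have := ih l'.length (by omega) l' rfl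
      rwa [h2, ← hw, mul_ofIdx_mul_ofIdx] at this
    · exact step _ i i.2 h (hw ▸ ih l.length (by omega) l rfl)

theorem exists_not_isPos_of_ne_one {w : P.weylGroup} (hw : w ≠ 1) :
    ∃ i ∈ b.support, ¬ b.IsPos (P.weylGroupToPerm w i) := by
  revert hw
  exact descent_induction b
    (p := fun w => w ≠ 1 → ∃ i ∈ b.support, ¬ b.IsPos (P.weylGroupToPerm w i))
    (fun h => absurd rfl h) (fun w i hi h _ _ => ⟨i, hi, h⟩) w

/-- A function that changes by `-1` under the simple reflections changes by the determinant. -/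
theorem eq_wdet_mul_of_simple {f : E → ℝ}
    (hf : ∀ i ∈ b.support, ∀ x, f (weylGroup.ofIdx P i • x) = -f x) (w : P.weylGroup) (x : E) :
    f (w • x) = wdet w * f x := by
  obtain ⟨l, rfl⟩ := exists_wordProd_eq b w
  induction l with
  | nil => rw [wordProd_nil, one_smul, wdet_one, one_mul]
  | cons i l ih =>
    rw [wordProd_cons, mul_smul, hf i i.2, ih, wdet_mul, wdet_ofIdx b]
    ring

/-! ### Positive roots and the cone they generate. -/

/-- The finite set of indices of positive roots. -/
def posRoots : Finset ι := (Set.toFinite {i | b.IsPos i}).toFinset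

theorem mem_posRoots {i : ι} : i ∈ posRoots b ↔ b.IsPos i := by simp [posRoots]

theorem mem_posRoots_of_mem_support {i : ι} (hi : i ∈ b.support) : i ∈ posRoots b :=
  (mem_posRoots b).2 (Base.isPos_of_mem_support hi)

theorem reflectionPerm_mem_posRoots_erase [DecidableEq ι] {i j : ι} (hi : i ∈ b.support)
    (hj : j ∈ (posRoots b).erase i) : P.reflectionPerm i j ∈ (posRoots b).erase i := by
  rw [Finset.mem_erase, mem_posRoots] at hj ⊢
  refine ⟨fun h => ?_, hj.2.reflectionPerm hi hj.1⟩
  have h' : j = P.reflectionPerm i i := by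
    have := congrArg (P.reflectionPerm i) h
    rwa [P.reflectionPerm_self] at this
  have h'' := hj.2
  rw [h', isPos_reflectionPerm_self_iff] at h''
  exact h'' (Base.isPos_of_mem_support hi)

/-- The reflection s_i permutes the positive roots other than α_i, so their terms cancel in pairs.
This evaluates both ρ on simple coroots and the sum of positive coroots on simple roots. -/
theorem sum_posRoots_eq_of_odd {i : ι} (hi : i ∈ b.support) {g : ι → ℝ}
    (hg : ∀ j, g (P.reflectionPerm i j) = -g j) : ∑ j ∈ posRoots b, g j = g i := by
  classical
  rw [← Finset.add_sum_erase _ _ (mem_posRoots_of_mem_support b hi)]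
  have : ∑ j ∈ (posRoots b).erase i, g j = 0 := by
    refine Finset.sum_involution (fun j _ => P.reflectionPerm i j) (fun j _ => ?_)
      (fun j _ h h' => h ?_) (fun j hj => reflectionPerm_mem_posRoots_erase b hi hj)
      (fun j _ => P.reflectionPerm_self i j)
    · rw [hg, add_neg_cancel]
    · have := hg j
      rw [h'] at this
      linarith
  rw [this, add_zero]

/-- The sum of the positive coroots, as a linear form. -/
def sumPosCoroots : E →ₗ[ℝ] ℝ := ∑ j ∈ posRoots b, P.coroot' j

theorem sumPosCoroots_apply (x : E) : sumPosCoroots b x = ∑ j ∈ posRoots b, P.coroot' j x := by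
  simp [sumPosCoroots]

theorem sumPosCoroots_root_of_mem_support {i : ι} (hi : i ∈ b.support) :
    sumPosCoroots b (P.root i) = 2 := by
  rw [sumPosCoroots_apply, sum_posRoots_eq_of_odd b hi]
  · simp
  · intro j
    rw [P.root_coroot'_eq_pairing, P.root_coroot'_eq_pairing, P.pairing_reflectionPerm,
      P.pairing_reflectionPerm_self_left]

/-- The form is 2 on every simple root, hence twice the height. -/
theorem sumPosCoroots_root_pos {i : ι} (hi : b.IsPos i) : 0 < sumPosCoroots b (P.root i) := by
  obtain ⟨g, -, -, hg⟩ := b.exists_root_eq_sum_int i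
  rw [Base.isPos_iff, Base.height_eq_sum hg] at hi
  have h : (0 : ℝ) < ((∑ j ∈ b.support, g j : ℤ) : ℝ) := by exact_mod_cast hi
  rw [hg, map_sum, Finset.sum_congr rfl fun j hj => by
    rw [map_zsmul, sumPosCoroots_root_of_mem_support b hj], ← Finset.sum_smul, zsmul_eq_mul]
  linarith

theorem root_mem_positiveRootCone {i : ι} (hi : b.IsPos i) : P.root i ∈ positiveRootCone b :=
  AddSubmonoid.subset_closure ⟨i, hi, rfl⟩

theorem eq_zero_or_sumPosCoroots_pos {x : E} (hx : x ∈ positiveRootCone b) :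
    x = 0 ∨ 0 < sumPosCoroots b x := by
  induction hx using AddSubmonoid.closure_induction with
  | mem x h =>
    obtain ⟨i, hi, rfl⟩ := h
    exact Or.inr (sumPosCoroots_root_pos b hi)
  | zero => exact Or.inl rfl
  | add x y _ _ hx hy =>
    rcases hx with rfl | hx
    · rwa [zero_add]
    rcases hy with rfl | hy
    · rw [add_zero]; exact Or.inr hx
    · rw [map_add]; exact Or.inr (add_pos hx hy)

theorem sumPosCoroots_nonneg {x : E} (hx : x ∈ positiveRootCone b) : 0 ≤ sumPosCoroots b x := by
  rcases eq_zero_or_sumPosCoroots_pos b hx with rfl | h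
  · simp
  · exact h.le

theorem eq_zero_of_mem_of_neg_mem {x : E} (hx : x ∈ positiveRootCone b)
    (hx' : -x ∈ positiveRootCone b) : x = 0 := by
  rcases eq_zero_or_sumPosCoroots_pos b hx with h | h
  · exact h
  · have := sumPosCoroots_nonneg b hx'
    rw [map_neg] at this
    linarith

theorem exists_int_coroot'_of_mem_positiveRootCone {x : E} (hx : x ∈ positiveRootCone b) (i : ι) :
    ∃ n : ℤ, P.coroot' i x = n := by
  induction hx using AddSubmonoid.closure_induction with
  | mem x h =>
    obtain ⟨j, -, rfl⟩ := h
    obtain ⟨k, hk⟩ := RootPairing.IsValuedIn.exists_value (P := P) (S := ℤ) j i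
    exact ⟨k, by rw [P.root_coroot'_eq_pairing, ← hk]; rfl⟩
  | zero => exact ⟨0, by simp⟩
  | add x y _ _ hx hy =>
    obtain ⟨m, hm⟩ := hx
    obtain ⟨n, hn⟩ := hy
    exact ⟨m + n, by rw [map_add, hm, hn]; push_cast; rfl⟩

theorem isPos_reflectionPerm_iff {i j : ι} (hj : j ∈ b.support) (hij : i ≠ j)
    (hij' : P.reflectionPerm j i ≠ j) : b.IsPos (P.reflectionPerm j i) ↔ b.IsPos i := by
  refine ⟨fun h => ?_, fun h => h.reflectionPerm hj hij⟩
  have := h.reflectionPerm hj hij'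
  rwa [P.reflectionPerm_self] at this

/-! ### Positive coroots and dominance. -/

/-- A root and its coroot are positive together: this is true of simple roots, and a simple
reflection s_j changes signs only at ±α_j on either side. Pointedness of the dual cone then rules
out the negative combination. -/
theorem coroot_mem_closure_of_isPos {i : ι} (hi : b.IsPos i) :
    P.coroot i ∈ AddSubmonoid.closure (P.coroot '' b.support) := by
  have hf : b.flip.IsPos i := by
    refine (hi.induction_on_reflect (p := fun i => b.IsPos i ↔ b.flip.IsPos i)
      (fun j hj => ?_) (fun i j h hj => ?_)).1 hi
    · exact iff_of_true (Base.isPos_of_mem_support hj) (Base.isPos_of_mem_support hj)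
    by_cases hij : i = j
    · subst hij
      exact (isPos_reflectionPerm_self_iff b i).trans
        ((not_congr h).trans (isPos_reflectionPerm_self_iff b.flip i).symm)
    by_cases hij' : P.reflectionPerm j i = j
    · rw [hij']
      exact iff_of_true (Base.isPos_of_mem_support hj) (Base.isPos_of_mem_support hj)
    exact (isPos_reflectionPerm_iff b hj hij hij').trans
      (h.trans (isPos_reflectionPerm_iff b.flip hj hij hij').symm)
  refine (b.coroot_mem_or_neg_mem i).resolve_right fun h => P.flip.ne_zero i ?_
  refine eq_zero_of_mem_of_neg_mem b.flip (root_mem_positiveRootCone b.flip hf) ?_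
  refine AddSubmonoid.closure_mono (Set.image_mono fun j hj => ?_) h
  exact Base.isPos_of_mem_support (b := b.flip) hj

theorem coroot'_mem_closure_of_isPos {i : ι} (hi : b.IsPos i) :
    P.coroot' i ∈ AddSubmonoid.closure (P.coroot' '' b.support) := by
  have := AddSubmonoid.mem_map_of_mem P.toLinearMap.flip.toAddMonoidHom
    (coroot_mem_closure_of_isPos b hi)
  rw [AddMonoidHom.map_mclosure, Set.image_image] at this
  exact this

theorem mem_dominantWeights_of_simple {x : E}
    (hx : ∀ i ∈ b.support, ∃ n : ℕ, P.coroot' i x = n) : x ∈ dominantWeights b := by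
  intro i hi
  have h := coroot'_mem_closure_of_isPos b hi
  generalize P.coroot' i = c at h
  induction h using AddSubmonoid.closure_induction with
  | mem c h =>
    obtain ⟨j, hj, rfl⟩ := h
    exact hx j hj
  | zero => exact ⟨0, by simp⟩
  | add c d _ _ hc hd =>
    obtain ⟨m, hm⟩ := hc
    obtain ⟨n, hn⟩ := hd
    exact ⟨m + n, by rw [LinearMap.add_apply, hm, hn]; push_cast; rfl⟩

theorem coroot'_reflectionPerm_self (i : ι) (x : E) :
    P.coroot' (P.reflectionPerm i i) x = -P.coroot' i x := by
  rw [P.coroot'_reflectionPerm, LinearMap.comp_apply, LinearEquiv.coe_coe, P.reflection_apply,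
    map_sub, map_smul, P.root_coroot'_eq_pairing, P.pairing_same, smul_eq_mul]
  ring

theorem coroot'_nonneg {x : E} (hx : x ∈ dominantWeights b) {i : ι} (hi : b.IsPos i) :
    0 ≤ P.coroot' i x := by
  obtain ⟨n, hn⟩ := hx i hi
  rw [hn]
  exact n.cast_nonneg

theorem coroot'_nonpos {x : E} (hx : x ∈ dominantWeights b) {i : ι} (hi : ¬ b.IsPos i) :
    P.coroot' i x ≤ 0 := by
  have := coroot'_nonneg b hx ((isPos_reflectionPerm_self_iff b i).2 hi)
  rw [coroot'_reflectionPerm_self] at this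
  linarith

theorem dominantWeights_subset_weightLattice {x : E} (hx : x ∈ dominantWeights b) :
    x ∈ weightLattice P := by
  intro i
  by_cases hi : b.IsPos i
  · obtain ⟨n, hn⟩ := hx i hi
    exact ⟨n, by rw [hn]; simp⟩
  · obtain ⟨n, hn⟩ := hx _ ((isPos_reflectionPerm_self_iff b i).2 hi)
    rw [coroot'_reflectionPerm_self] at hn
    exact ⟨-n, by push_cast; linarith⟩

theorem add_mem_dominantWeights {x y : E} (hx : x ∈ dominantWeights b)
    (hy : y ∈ dominantWeights b) : x + y ∈ dominantWeights b := by
  intro i hi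
  obtain ⟨m, hm⟩ := hx i hi
  obtain ⟨n, hn⟩ := hy i hi
  exact ⟨m + n, by rw [map_add, hm, hn]; push_cast; rfl⟩

/-- Descent: if wα_i is negative and w' = ws_i, then w'α_i is positive and x - wx = (x - w'x) + ⟨x,
α_i^∨⟩ w'α_i. -/
theorem sub_smul_mem_positiveRootCone {x : E} (hx : x ∈ dominantWeights b) (w : P.weylGroup) :
    x - w • x ∈ positiveRootCone b := by
  refine descent_induction b (p := fun w => x - w • x ∈ positiveRootCone b) ?_
    (fun w i hi h ih => ?_) w
  · rw [one_smul, sub_self]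
    exact zero_mem _
  · obtain ⟨n, hn⟩ := hx i (Base.isPos_of_mem_support hi)
    have hr := (weylGroupToPerm_mul_ofIdx_self b w i).2 h
    have : x - w • x = (x - (w * weylGroup.ofIdx P i) • x) +
        n • P.root (P.weylGroupToPerm (w * weylGroup.ofIdx P i) i) := by
      have hx' : w • x = (w * weylGroup.ofIdx P i) • weylGroup.ofIdx P i • x := by
        rw [← mul_smul, mul_ofIdx_mul_ofIdx]
      rw [hx', ofIdx_smul_eq, hn, smul_sub, smul_real_smul, P.weylGroup_apply_root,
        Nat.cast_smul_eq_nsmul]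
      abel
    rw [this]
    exact add_mem ih (nsmul_mem (root_mem_positiveRootCone b hr) n)

theorem smul_eq_self_of_mem_dominantWeights {x : E} (hx : x ∈ dominantWeights b)
    {w : P.weylGroup} (hw : w • x ∈ dominantWeights b) : w • x = x := by
  have h1 := sub_smul_mem_positiveRootCone b hx w
  have h2 := sub_smul_mem_positiveRootCone b hw w⁻¹
  rw [inv_smul_smul] at h2
  have := eq_zero_of_mem_of_neg_mem b h1 (by rwa [neg_sub])
  exact (sub_eq_zero.1 this).symm

/-- If w ≠ 1 made a simple α_i negative, dominance of wx would force ⟨wx, wα_i^∨⟩ = ⟨x, α_i^∨⟩ to be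
nonpositive. -/
theorem eq_one_of_smul_mem_dominantWeights {x : E} (hx : ∀ i ∈ b.support, 0 < P.coroot' i x)
    {w : P.weylGroup} (hw : w • x ∈ dominantWeights b) : w = 1 := by
  by_contra h
  obtain ⟨i, hi, hn⟩ := exists_not_isPos_of_ne_one b h
  have := coroot'_nonpos b hw hn
  rw [coroot'_weylGroupToPerm_smul] at this
  exact (hx i hi).not_ge this

theorem eq_zero_of_coroot'_eq_zero {x : E} (hx : ∀ i ∈ b.support, P.coroot' i x = 0) : x = 0 := by
  have h : P.toLinearMap x = 0 := by
    refine b.toCoweightBasis.ext fun i => ?_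
    rw [Base.toCoweightBasis_apply]
    exact hx i i.2
  exact P.toPerfPair.injective (by rw [map_zero]; exact h)

/-- The sum of the positive coroots is both nonnegative and nonpositive at x, so each term vanishes.
-/
theorem eq_zero_of_mem_dominantWeights_of_neg_mem {x : E} (hx : x ∈ dominantWeights b)
    (hx' : -x ∈ positiveRootCone b) : x = 0 := by
  have h := sumPosCoroots_nonneg b hx'
  rw [map_neg, sumPosCoroots_apply] at h
  have hn : ∀ j ∈ posRoots b, 0 ≤ P.coroot' j x := fun j hj =>
    coroot'_nonneg b hx ((mem_posRoots b).1 hj)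
  have h0 : ∑ j ∈ posRoots b, P.coroot' j x = 0 :=
    le_antisymm (by linarith) (Finset.sum_nonneg hn)
  exact eq_zero_of_coroot'_eq_zero b fun i hi =>
    (Finset.sum_eq_zero_iff_of_nonneg hn).1 h0 i (mem_posRoots_of_mem_support b hi)

/-! ### The vector ρ and finiteness below a weight. -/

theorem rho_eq : rho b = (1 / 2 : ℝ) • ∑ i ∈ posRoots b, P.root i := by
  rw [rho, finsum_cond_eq_sum_of_cond_iff]
  intro i _
  exact (mem_posRoots b).symm

theorem coroot'_rho {i : ι} (hi : i ∈ b.support) : P.coroot' i (rho b) = 1 := by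
  rw [rho_eq, map_smul, map_sum, sum_posRoots_eq_of_odd b hi]
  · rw [P.root_coroot'_eq_pairing, P.pairing_same]
    norm_num
  · intro j
    rw [P.root_coroot'_eq_pairing, P.root_coroot'_eq_pairing, ← P.pairing_reflectionPerm,
      P.pairing_reflectionPerm_self_right]

theorem rho_mem_dominantWeights : rho b ∈ dominantWeights b :=
  mem_dominantWeights_of_simple b fun i hi => ⟨1, by rw [coroot'_rho b hi]; simp⟩

theorem coroot'_add_rho_pos {x : E} (hx : x ∈ dominantWeights b) {i : ι} (hi : i ∈ b.support) :
    0 < P.coroot' i (x + rho b) := by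
  rw [map_add, coroot'_rho b hi]
  have := coroot'_nonneg b hx (Base.isPos_of_mem_support hi)
  linarith

theorem sub_rho_mem_dominantWeights {x : E} (hx : x ∈ dominantWeights b)
    (h : ∀ i ∈ b.support, P.coroot' i x ≠ 0) : x - rho b ∈ dominantWeights b := by
  refine mem_dominantWeights_of_simple b fun i hi => ?_
  obtain ⟨n, hn⟩ := hx i (Base.isPos_of_mem_support hi)
  have h0 := h i hi
  rw [hn] at h0
  obtain ⟨m, rfl⟩ := Nat.exists_eq_succ_of_ne_zero (Nat.cast_ne_zero.1 h0)
  exact ⟨m, by rw [map_sub, hn, coroot'_rho b hi]; push_cast; ring⟩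

/-- The simple coroots take natural values on u, bounded by `sumPosCoroots b v`, and these values
determine u. -/
theorem finite_strictlyBelow (v : E) :
    {u | u ∈ dominantWeights b ∧ StrictlyBelow b u v}.Finite := by
  classical
  obtain ⟨N, hN⟩ := exists_nat_ge (sumPosCoroots b v)
  let S : Set (b.support → ℝ) := Set.pi Set.univ fun _ => (Nat.cast '' Set.Iic N)
  have hS : S.Finite := Set.Finite.pi fun _ => (Set.finite_Iic N).image _
  let φ : E → b.support → ℝ := fun u i => P.coroot' i u
  have hφ : Function.Injective φ := fun u u' h => by
    refine sub_eq_zero.1 (eq_zero_of_coroot'_eq_zero b fun i hi => ?_)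
    rw [map_sub, sub_eq_zero]
    exact congrFun h ⟨i, hi⟩
  refine (hS.preimage hφ.injOn).subset ?_
  rintro u ⟨hu, huv, -⟩ i -
  obtain ⟨n, hn⟩ := hu i (Base.isPos_of_mem_support i.2)
  refine ⟨n, ?_, hn.symm⟩
  have h1 := sumPosCoroots_nonneg b huv
  have h2 : P.coroot' i u ≤ sumPosCoroots b u := by
    rw [sumPosCoroots_apply]
    exact Finset.single_le_sum (f := fun j => P.coroot' j u)
      (fun j hj => coroot'_nonneg b hu ((mem_posRoots b).1 hj))
      (mem_posRoots_of_mem_support b i.2)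
  rw [map_sub] at h1
  rw [Set.mem_Iic]
  exact_mod_cast (by linarith : (n : ℝ) ≤ N)

/-! ### Alternants and the Weyl denominator formula. -/

theorem alternant_eq [Fintype P.weylGroup] (x : E) :
    alternant P x = ∑ w : P.weylGroup, wdet w • fexp (w • x) := by
  rw [alternant, finsum_eq_sum_of_fintype]

include b in
theorem alternant_smul (w : P.weylGroup) (x : E) :
    alternant P (w • x) = wdet w • alternant P x := by
  have := Fintype.ofFinite P.weylGroup
  rw [alternant_eq, alternant_eq, Finset.smul_sum]
  refine Fintype.sum_equiv (Equiv.mulRight w) _ _ fun w' => ?_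
  rw [Equiv.coe_mulRight, wdet_mul, mul_smul w' w x, smul_smul (wdet w), mul_left_comm,
    wdet_mul_self b, mul_one]

-- The reflection fixes x and has determinant -1, so the alternant equals its own negative.
include b in
theorem alternant_eq_zero {x : E} {i : ι} (h : P.coroot' i x = 0) : alternant P x = 0 := by
  have h' := alternant_smul b (weylGroup.ofIdx P i) x
  rw [wdet_ofIdx b, ofIdx_smul_eq, h, zero_smul, sub_zero, neg_one_smul, eq_neg_iff_add_eq_zero,
    ← two_smul ℝ] at h'
  exact (smul_eq_zero.1 h').resolve_left two_ne_zero

theorem denominator_eq : denominator b = ∏ i ∈ posRoots b,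
    (fexp ((1 / 2 : ℝ) • P.root i) - fexp (-((1 / 2 : ℝ) • P.root i))) := by
  rw [denominator, finprod_cond_eq_prod_of_cond_iff]
  intro i _
  exact (mem_posRoots b).symm

/-- The factor at α_i changes sign and the other factors are permuted. -/
theorem actHom_denominator {i : ι} (hi : i ∈ b.support) :
    actHom (weylGroup.ofIdx P i) (denominator b) = -denominator b := by
  classical
  have hf : ∀ j, actHom (weylGroup.ofIdx P i)
      (fexp ((1 / 2 : ℝ) • P.root j) - fexp (-((1 / 2 : ℝ) • P.root j))) =
      fexp ((1 / 2 : ℝ) • P.root (P.reflectionPerm i j)) -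
        fexp (-((1 / 2 : ℝ) • P.root (P.reflectionPerm i j))) := fun j => by
    rw [map_sub, actHom_fexp, actHom_fexp, smul_neg, smul_real_smul, P.weylGroup_apply_root,
      weylGroupToPerm_ofIdx]
  rw [denominator_eq, map_prod, ← Finset.mul_prod_erase _ _ (mem_posRoots_of_mem_support b hi),
    ← Finset.mul_prod_erase _ _ (mem_posRoots_of_mem_support b hi), hf, ← neg_mul]
  congr 1
  · rw [P.root_reflectionPerm, P.reflection_apply_self, smul_neg, neg_neg, neg_sub]
  · exact Finset.prod_bij' (fun j _ => P.reflectionPerm i j) (fun j _ => P.reflectionPerm i j)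
      (fun j hj => reflectionPerm_mem_posRoots_erase b hi hj)
      (fun j hj => reflectionPerm_mem_posRoots_erase b hi hj)
      (fun j _ => P.reflectionPerm_self i j) (fun j _ => P.reflectionPerm_self i j)
      (fun j _ => hf j)

theorem coeff_denominator_smul (w : P.weylGroup) (x : E) :
    (denominator b).coeff (w • x) = wdet w * (denominator b).coeff x := by
  refine eq_wdet_mul_of_simple b (f := (denominator b).coeff) (fun i hi x => ?_) w x
  have h := coeff_actHom (weylGroup.ofIdx P i) (denominator b) x
  rw [actHom_denominator b hi, AddMonoidAlgebra.coeff_neg, Finsupp.neg_apply] at h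
  rw [← h, neg_neg]

/-- Choosing the second term of a factor lowers the exponent by a positive root, so the top exponent
arises in one way only. Arbitrary sets of positive roots allow induction. -/
theorem coeff_denominator_aux (s : Finset ι) (hs : ∀ i ∈ s, b.IsPos i) :
    (∏ i ∈ s, (fexp ((1 / 2 : ℝ) • P.root i) - fexp (-((1 / 2 : ℝ) • P.root i)))).coeff
        ((1 / 2 : ℝ) • ∑ i ∈ s, P.root i) = 1 ∧
      ∀ x, (∏ i ∈ s, (fexp ((1 / 2 : ℝ) • P.root i) -
        fexp (-((1 / 2 : ℝ) • P.root i)))).coeff x ≠ 0 →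
          (1 / 2 : ℝ) • ∑ i ∈ s, P.root i - x ∈ positiveRootCone b := by
  classical
  induction s using Finset.induction_on with
  | empty =>
    have h1 : ∀ x : E, (1 : AddMonoidAlgebra ℝ E).coeff x = if (0 : E) = x then 1 else 0 :=
      fun x => coeff_fexp 0 x
    refine ⟨by simp [h1], fun x hx => ?_⟩
    rw [Finset.prod_empty, h1] at hx
    have : x = 0 := by
      by_contra h
      exact hx (if_neg (Ne.symm h))
    simp [this]
  | insert j s hj ih =>
    obtain ⟨ih1, ih2⟩ := ih fun i hi => hs i (Finset.mem_insert_of_mem hi)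
    have hjp := hs j (Finset.mem_insert_self j s)
    rw [Finset.prod_insert hj, Finset.sum_insert hj]
    set z := ∏ i ∈ s, (fexp ((1 / 2 : ℝ) • P.root i) - fexp (-((1 / 2 : ℝ) • P.root i)))
    set r := ∑ i ∈ s, P.root i
    have hc : ∀ x, ((fexp ((1 / 2 : ℝ) • P.root j) - fexp (-((1 / 2 : ℝ) • P.root j))) * z).coeff x
        = z.coeff (x - (1 / 2 : ℝ) • P.root j) - z.coeff (x + (1 / 2 : ℝ) • P.root j) := fun x => by
      rw [sub_mul, AddMonoidAlgebra.coeff_sub, Finsupp.sub_apply, coeff_fexp_mul, coeff_fexp_mul,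
        sub_neg_eq_add]
    constructor
    · have e1 : (1 / 2 : ℝ) • (P.root j + r) - (1 / 2 : ℝ) • P.root j = (1 / 2 : ℝ) • r := by
        module
      have e2 : z.coeff ((1 / 2 : ℝ) • (P.root j + r) + (1 / 2 : ℝ) • P.root j) = 0 := by
        by_contra h
        have h' := ih2 _ h
        rw [show (1 / 2 : ℝ) • r - ((1 / 2 : ℝ) • (P.root j + r) + (1 / 2 : ℝ) • P.root j) =
          -P.root j by module] at h'
        exact P.ne_zero j
          (eq_zero_of_mem_of_neg_mem b (root_mem_positiveRootCone b hjp) h')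
      rw [hc, e1, e2, ih1, sub_zero]
    · intro x hx
      rw [hc] at hx
      by_cases h : z.coeff (x - (1 / 2 : ℝ) • P.root j) = 0
      · have h' : z.coeff (x + (1 / 2 : ℝ) • P.root j) ≠ 0 := fun h0 => hx (by rw [h, h0, sub_zero])
        rw [show (1 / 2 : ℝ) • (P.root j + r) - x =
          ((1 / 2 : ℝ) • r - (x + (1 / 2 : ℝ) • P.root j)) + P.root j by module]
        exact add_mem (ih2 _ h') (root_mem_positiveRootCone b hjp)
      · rw [show (1 / 2 : ℝ) • (P.root j + r) - x =
          (1 / 2 : ℝ) • r - (x - (1 / 2 : ℝ) • P.root j) by module]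
        exact ih2 _ h

theorem coeff_denominator_rho : (denominator b).coeff (rho b) = 1 := by
  rw [denominator_eq, rho_eq]
  exact (coeff_denominator_aux b _ fun i hi => (mem_posRoots b).1 hi).1

theorem rho_sub_mem_positiveRootCone {x : E} (hx : (denominator b).coeff x ≠ 0) :
    rho b - x ∈ positiveRootCone b := by
  rw [denominator_eq] at hx
  rw [rho_eq]
  exact (coeff_denominator_aux b _ fun i hi => (mem_posRoots b).1 hi).2 x hx

theorem smul_rho_injective {w w' : P.weylGroup} (h : w • rho b = w' • rho b) : w = w' := by
  have : (w'⁻¹ * w) • rho b = rho b := by rw [mul_smul, h, inv_smul_smul]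
  have h1 := eq_one_of_smul_mem_dominantWeights b (x := rho b) (w := w'⁻¹ * w)
    (fun i hi => by rw [coroot'_rho b hi]; exact one_pos)
    (by rw [this]; exact rho_mem_dominantWeights b)
  exact (inv_mul_eq_one.1 h1).symm

/-- The support of the Weyl denominator is contained in the Weyl group orbit of `ρ`. -/
theorem exists_smul_rho_eq {x : E} (hx : (denominator b).coeff x ≠ 0) :
    ∃ w : P.weylGroup, w • rho b = x := by
  have hl : x ∈ weightLattice P := fun i => by
    obtain ⟨m, hm⟩ :=
      exists_int_coroot'_of_mem_positiveRootCone b (rho_sub_mem_positiveRootCone b hx) i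
    obtain ⟨n, hn⟩ := dominantWeights_subset_weightLattice b (rho_mem_dominantWeights b) i
    rw [map_sub, hn] at hm
    exact ⟨n - m, by push_cast; linarith⟩
  obtain ⟨w, hw, -⟩ := exists_isShortestDominating b hl
  have hne : (denominator b).coeff (w • x) ≠ 0 := by
    rw [coeff_denominator_smul]
    refine mul_ne_zero (fun h => ?_) hx
    have := wdet_mul_self b w
    rw [h, mul_zero] at this
    exact zero_ne_one this
  -- Antisymmetry kills coefficients on walls. So wx is regular dominant and wx - ρ is dominant,
  -- while ρ - wx lies in the positive cone; hence wx = ρ.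
  have hreg : ∀ i ∈ b.support, P.coroot' i (w • x) ≠ 0 := fun i _ h => hne <| by
    have := coeff_denominator_smul b (weylGroup.ofIdx P i) (w • x)
    rw [wdet_ofIdx b, ofIdx_smul_eq, h, zero_smul, sub_zero] at this
    linarith
  have h0 := eq_zero_of_mem_dominantWeights_of_neg_mem b (sub_rho_mem_dominantWeights b hw hreg)
    (by rw [neg_sub]; exact rho_sub_mem_positiveRootCone b hne)
  exact ⟨w⁻¹, by rw [← sub_eq_zero.1 h0, inv_smul_smul]⟩

/-- The Weyl denominator formula. -/
theorem denominator_eq_alternant : denominator b = alternant P (rho b) := by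
  classical
  have := Fintype.ofFinite P.weylGroup
  apply AddMonoidAlgebra.coeff_injective
  ext x
  have hc : (alternant P (rho b)).coeff x =
      ∑ w : P.weylGroup, if w • rho b = x then wdet w else 0 := by
    rw [alternant_eq, AddMonoidAlgebra.coeff_sum, Finsupp.finsetSum_apply]
    refine Finset.sum_congr rfl fun w _ => ?_
    rw [AddMonoidAlgebra.coeff_smul_apply, coeff_fexp, smul_eq_mul, mul_ite, mul_one, mul_zero]
  rw [hc]
  -- Both sides have coefficient det(w) at wρ, since ρ has trivial stabilizer, and none off its
  -- orbit.
  by_cases h : ∃ w : P.weylGroup, w • rho b = x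
  · obtain ⟨w, rfl⟩ := h
    rw [coeff_denominator_smul, coeff_denominator_rho, mul_one, Fintype.sum_eq_single w, if_pos rfl]
    exact fun w' hw' => if_neg fun h => hw' (smul_rho_injective b h)
  · rw [Finset.sum_eq_zero fun w _ => if_neg fun hw => h ⟨w, hw⟩]
    by_contra hx
    exact h (exists_smul_rho_eq b hx)

/-! ### Expanding δ m_λ in alternants and identifying coefficients. -/

theorem finite_orbit (x : E) : (MulAction.orbit P.weylGroup x).Finite :=
  Set.finite_range _

/-- The product of a symmetric monomial and an alternant is a sum of alternants. -/
theorem monomial_mul_alternant (x y : E) :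
    monomial P x * alternant P y =
      ∑ u ∈ (finite_orbit (P := P) x).toFinset, alternant P (u + y) := by
  have := Fintype.ofFinite P.weylGroup
  rw [monomial, finsum_mem_eq_finite_toFinset_sum _ (finite_orbit (P := P) x), alternant_eq,
    Finset.mul_sum]
  simp_rw [alternant_eq]
  rw [Finset.sum_comm]
  refine Finset.sum_congr rfl fun w _ => ?_
  rw [Finset.sum_mul]
  -- For fixed w, e^u e^{wy} = e^{w(w⁻¹u + y)}, and w⁻¹ permutes the orbit.
  refine Finset.sum_bij' (fun u _ => w⁻¹ • u) (fun u _ => w • u) ?_ ?_ ?_ ?_ ?_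
  · intro u hu
    rw [Set.Finite.mem_toFinset] at hu ⊢
    exact MulAction.mem_orbit_of_mem_orbit _ hu
  · intro u hu
    rw [Set.Finite.mem_toFinset] at hu ⊢
    exact MulAction.mem_orbit_of_mem_orbit _ hu
  · intro u _; exact smul_inv_smul w u
  · intro u _; exact inv_smul_smul w u
  · intro u _
    rw [mul_smul_comm, fexp_mul_fexp, smul_add, smul_inv_smul]

theorem algebraMap_denominator_mul_weylCharacter (x : E) :
    algebraMap (AddMonoidAlgebra ℝ E) (FractionRing (AddMonoidAlgebra ℝ E)) (denominator b) *
      weylCharacter b x =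
    algebraMap (AddMonoidAlgebra ℝ E) (FractionRing (AddMonoidAlgebra ℝ E))
      (alternant P (x + rho b)) := by
  rw [weylCharacter, mul_inv_cancel_left₀]
  rw [Ne, FaithfulSMul.algebraMap_eq_zero_iff]
  exact denominator_ne_zero b

theorem rho_add_mem_weightLattice {v x : E} (hv : v ∈ dominantWeights b)
    (hx : x ∈ MulAction.orbit P.weylGroup v) : rho b + x ∈ weightLattice P := by
  obtain ⟨w, rfl⟩ := hx
  intro i
  obtain ⟨m, hm⟩ := dominantWeights_subset_weightLattice b (rho_mem_dominantWeights b) i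
  obtain ⟨n, hn⟩ := smul_mem_weightLattice (dominantWeights_subset_weightLattice b hv) w i
  exact ⟨m + n, by rw [map_add, hm, hn]; push_cast; rfl⟩

theorem add_rho_mem_orbit_iff {u x : E} (hu : u ∈ dominantWeights b) {w : P.weylGroup}
    (hw : w • (rho b + x) ∈ dominantWeights b) :
    x + rho b ∈ MulAction.orbit P.weylGroup (u + rho b) ↔ w • (rho b + x) = u + rho b := by
  rw [add_comm (rho b) x] at hw ⊢
  constructor
  · rintro ⟨g, hg⟩
    change g • (u + rho b) = x + rho b at hg
    rw [← hg, ← mul_smul] at hw ⊢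
    exact smul_eq_self_of_mem_dominantWeights b
      (add_mem_dominantWeights b hu (rho_mem_dominantWeights b)) hw
  · intro h
    exact ⟨w⁻¹, by rw [← h]; exact inv_smul_smul w _⟩

theorem inverseKostka_eq_sum (v u : E)
    [DecidablePred (· ∈ MulAction.orbit P.weylGroup (u + rho b))] :
    inverseKostka b v u = ∑ x ∈ (finite_orbit (P := P) v).toFinset,
      if x + rho b ∈ MulAction.orbit P.weylGroup (u + rho b) then
        wdet (shortestDominating b (rho b + x)) else 0 := by
  classical
  rw [inverseKostka, ← Finset.sum_filter]
  refine finsum_cond_eq_sum_of_cond_iff _ fun {x} _ => ?_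
  rw [Finset.mem_filter, Set.Finite.mem_toFinset]
  refine and_congr_right fun _ => ⟨?_, fun h => ⟨_, h, add_sub_cancel_right x _⟩⟩
  rintro ⟨y, hy, rfl⟩
  rwa [sub_add_cancel]

theorem inverseKostka_self {v : E} (hv : v ∈ dominantWeights b) : inverseKostka b v v = 1 := by
  classical
  rw [inverseKostka_eq_sum, Finset.sum_eq_single v]
  · rw [if_pos (MulAction.mem_orbit_self _)]
    have h := (shortestDominating_spec b
      (rho_add_mem_weightLattice b hv (MulAction.mem_orbit_self v))).1
    rw [eq_one_of_smul_mem_dominantWeights b (fun i hi => ?_) h, wdet_one]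
    rw [add_comm]
    exact coroot'_add_rho_pos b hv hi
  · intro x hx hxv
    rw [Set.Finite.mem_toFinset] at hx
    refine if_neg fun h => hxv ?_
    obtain ⟨g, rfl⟩ := hx
    obtain ⟨w, hw⟩ := h
    change w • (v + rho b) = g • v + rho b at hw
    have h1 := sub_smul_mem_positiveRootCone b hv (w⁻¹ * g)
    have h2 := sub_smul_mem_positiveRootCone b (rho_mem_dominantWeights b) w⁻¹
    -- Both differences lie in the pointed cone, so both vanish. Then w fixes ρ, hence w = 1 and
    -- only ν = λ contributes.
    have h3 : v - (w⁻¹ * g) • v = -(rho b - w⁻¹ • rho b) := by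
      have := congrArg (w⁻¹ • ·) hw
      simp only [smul_add, ← mul_smul, inv_mul_cancel, one_smul] at this
      rw [neg_sub, sub_eq_sub_iff_add_eq_add, this, add_comm]
    rw [h3] at h1
    have h4 := sub_eq_zero.1 (eq_zero_of_mem_of_neg_mem b h2 h1)
    have h5 : w⁻¹ = 1 := smul_rho_injective b (by rw [← h4, one_smul])
    rw [inv_eq_one.1 h5, one_smul] at hw
    exact (add_right_cancel hw).symm
  · intro h
    exact absurd ((Set.Finite.mem_toFinset _).2 (MulAction.mem_orbit_self v)) h

/-- With x = gv, the difference splits as (v - wgv) + (ρ - wρ), and both v and ρ are dominant. -/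
theorem sub_mem_positiveRootCone_of_smul_eq {v u x : E} (hv : v ∈ dominantWeights b)
    (hx : x ∈ MulAction.orbit P.weylGroup v) {w : P.weylGroup}
    (h : w • (rho b + x) = u + rho b) : v - u ∈ positiveRootCone b := by
  obtain ⟨g, rfl⟩ := hx
  change w • (rho b + g • v) = u + rho b at h
  have h1 := sub_smul_mem_positiveRootCone b hv (w * g)
  have h2 := sub_smul_mem_positiveRootCone b (rho_mem_dominantWeights b) w
  have h3 : v - u = (v - (w * g) • v) + (rho b - w • rho b) := by
    rw [eq_sub_of_add_eq h.symm, smul_add, mul_smul]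
    abel
  rw [h3]
  exact add_mem h1 h2

theorem alternant_add_rho_eq_sum {v x : E} (hv : v ∈ dominantWeights b)
    (hx : x ∈ MulAction.orbit P.weylGroup v) {T : Finset E}
    (hT : ∀ u, u ∈ T ↔ u ∈ dominantWeights b ∧ v - u ∈ positiveRootCone b)
    [∀ u, Decidable (x + rho b ∈ MulAction.orbit P.weylGroup (u + rho b))] :
    alternant P (x + rho b) = ∑ u ∈ T,
      (if x + rho b ∈ MulAction.orbit P.weylGroup (u + rho b) then
        wdet (shortestDominating b (rho b + x)) else 0) • alternant P (u + rho b) := by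
  have hw := (shortestDominating_spec b (rho_add_mem_weightLattice b hv hx)).1
  set w := shortestDominating b (rho b + x)
  have ha : alternant P (x + rho b) = wdet w • alternant P (w • (rho b + x)) := by
    rw [alternant_smul b, smul_smul, wdet_mul_self b, one_smul, add_comm]
  rw [ha]
  -- Regular case: exactly one u survives, namely w(ρ+x) - ρ. Singular case: the alternant vanishes,
  -- and so does every coefficient, since u + ρ is regular.
  by_cases hreg : ∀ i ∈ b.support, P.coroot' i (w • (rho b + x)) ≠ 0
  · have hu := sub_rho_mem_dominantWeights b hw hreg
    have hwu : w • (rho b + x) = w • (rho b + x) - rho b + rho b := (sub_add_cancel _ _).symm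
    rw [Finset.sum_eq_single (w • (rho b + x) - rho b),
      if_pos ((add_rho_mem_orbit_iff b hu hw).2 hwu), sub_add_cancel]
    · intro u huT hne
      rw [if_neg fun h => hne ?_, zero_smul]
      rw [(add_rho_mem_orbit_iff b ((hT u).1 huT).1 hw).1 h, add_sub_cancel_right]
    · intro h
      exact absurd ((hT _).2 ⟨hu, sub_mem_positiveRootCone_of_smul_eq b hv hx hwu⟩) h
  · push Not at hreg
    obtain ⟨i, hi, h0⟩ := hreg
    rw [alternant_eq_zero b h0, smul_zero, Finset.sum_eq_zero]
    intro u huT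
    have hu := ((hT u).1 huT).1
    rw [if_neg fun h => ?_, zero_smul]
    rw [(add_rho_mem_orbit_iff b hu hw).1 h] at h0
    exact (coroot'_add_rho_pos b hu hi).ne' h0

theorem denominator_mul_monomial {v : E} (hv : v ∈ dominantWeights b) :
    denominator b * monomial P v = alternant P (v + rho b) +
      ∑ u ∈ (finite_strictlyBelow b v).toFinset,
        inverseKostka b v u • alternant P (u + rho b) := by
  classical
  have hvS : v ∉ (finite_strictlyBelow b v).toFinset := fun h =>
    ((Set.Finite.mem_toFinset _).1 h).2.2 rfl
  have hT : ∀ u, u ∈ insert v (finite_strictlyBelow b v).toFinset ↔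
      u ∈ dominantWeights b ∧ v - u ∈ positiveRootCone b := fun u => by
    rw [Finset.mem_insert, Set.Finite.mem_toFinset]
    constructor
    · rintro (rfl | h)
      · exact ⟨hv, by rw [sub_self]; exact zero_mem _⟩
      · exact ⟨h.1, h.2.1⟩
    · intro h
      by_cases huv : u = v
      · exact Or.inl huv
      · exact Or.inr ⟨h.1, h.2, huv⟩
  -- The leading term joins the sum as the index u = v, which allows the orbit sum and the sum over
  -- u to be interchanged.
  have h1 : alternant P (v + rho b) = inverseKostka b v v • alternant P (v + rho b) := by
    rw [inverseKostka_self b hv, one_smul]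
  rw [mul_comm, denominator_eq_alternant, monomial_mul_alternant, h1,
    ← Finset.sum_insert (f := fun u => inverseKostka b v u • alternant P (u + rho b)) hvS,
    Finset.sum_congr rfl fun x hx =>
      alternant_add_rho_eq_sum b hv ((Set.Finite.mem_toFinset _).1 hx) hT, Finset.sum_comm]
  refine Finset.sum_congr rfl fun u _ => ?_
  rw [← Finset.sum_smul, ← inverseKostka_eq_sum]

end Base
end WeylCharacter
end

theorem corollary6p3 {ι E F : Type*} [Finite ι] [AddCommGroup E] [Module ℝ E]
    [AddCommGroup F] [Module ℝ F] (P : RootPairing ι ℝ E F) [P.IsRootSystem]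
    [P.IsCrystallographic] [P.IsReduced] [P.IsIrreducible] (b : P.Base)
    (v : E) (hv : v ∈ WeylCharacter.dominantWeights b) :
    {u | u ∈ WeylCharacter.dominantWeights b ∧ WeylCharacter.StrictlyBelow b u v}.Finite ∧
    algebraMap (AddMonoidAlgebra ℝ E) (FractionRing (AddMonoidAlgebra ℝ E))
        (WeylCharacter.monomial P v) =
      WeylCharacter.weylCharacter b v +
        ∑ᶠ u ∈ {u | u ∈ WeylCharacter.dominantWeights b ∧ WeylCharacter.StrictlyBelow b u v},
          WeylCharacter.inverseKostka b v u • WeylCharacter.weylCharacter b u := by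
  refine ⟨WeylCharacter.finite_strictlyBelow b v, ?_⟩
  rw [finsum_mem_eq_finite_toFinset_sum _ (WeylCharacter.finite_strictlyBelow b v)]
  have h0 : algebraMap (AddMonoidAlgebra ℝ E) (FractionRing (AddMonoidAlgebra ℝ E))
      (WeylCharacter.denominator b) ≠ 0 := by
    rw [Ne, FaithfulSMul.algebraMap_eq_zero_iff]
    exact WeylCharacter.denominator_ne_zero b
  refine mul_left_cancel₀ h0 ?_
  rw [← map_mul, WeylCharacter.denominator_mul_monomial b hv, map_add, map_sum, mul_add,
    WeylCharacter.algebraMap_denominator_mul_weylCharacter, Finset.mul_sum]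
  congr 1
  refine Finset.sum_congr rfl fun u _ => ?_
  rw [mul_smul_comm, WeylCharacter.algebraMap_denominator_mul_weylCharacter,
    Algebra.algebraMap_eq_smul_one, Algebra.algebraMap_eq_smul_one, smul_assoc]
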